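/- For every integer $k\ge 1$ there is a constant $C>0$, depending only on $k$, such that the following holds. Let $(\alpha_1,\dots,\alpha_k)$ be any $k$-tuple of nonzero real numbers and let $E\subset\mathbb{R}^2$ be any finite set, with $n=|E|$ points. Then the number of $k$-chains of type $(\alpha_1,\dots,\alpha_k)$ in $E$, that is, of $(k+1)$-tuples $(R_1,\dots,R_{k+1})\in E^{k+1}$ of (not necessarily distinct) points with $R_j\cdot R_{j+1}=\alpha_j$ for all $j=1,\dots,k$, is at most $C\,n^{2(k+1)/3}$. -/

import Mathlib

open Classical in
/-- The set of `k`-chains of type `α = (α₁, …, αₖ)` in the finite planar point set `E`: all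
`(k+1)`-tuples `(R₁, …, R_{k+1})` of (not necessarily distinct) points of `E` whose successive
dot products are `R_j · R_{j+1} = α_j` for `j = 1, …, k`. -/
noncomputable def dotChains {k : ℕ} (α : Fin k → ℝ) (E : Finset (EuclideanSpace ℝ (Fin 2))) :
    Finset (Fin (k + 1) → EuclideanSpace ℝ (Fin 2)) :=
  (Fintype.piFinset fun _ : Fin (k + 1) => E).filter
    fun R => ∀ j : Fin k, inner ℝ (R j.castSucc) (R j.succ) = α j

theorem mem_dotChains {k : ℕ} (α : Fin k → ℝ) (E : Finset (EuclideanSpace ℝ (Fin 2)))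
    (R : Fin (k + 1) → EuclideanSpace ℝ (Fin 2)) :
    R ∈ dotChains α E ↔
      (∀ i, R i ∈ E) ∧ ∀ j : Fin k, inner ℝ (R j.castSucc) (R j.succ) = α j := by
  simp [dotChains]

/-! Pairing consecutive points cuts a chain into disjoint edges. Forgetting the conditions between
these edges, each is one of $O(n^{4/3})$ pairs with a prescribed nonzero dot product
(`card_dotPairs_le`), so each edge costs exponent $2/3$ per point. For even $k$ three points are
left over, and a 2-chain has $O(n^2)$ choices (`card_dotChains_two_le`), again $2/3$ per point.

The pair bound is Szemerédi–Trotter for the points $x$ and the lines $\{x : x\cdot y=\alpha\}$. It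
follows Székely's argument: consecutive points on each line are joined by segments, and a crossing
inequality (`IsSegmentFamily.sq_mul_card_le`) comes from random sampling applied to a linear bound
for non-crossing families. That linear bound is obtained without Euler's formula, by charging
segments to vertices (`IsSegmentFamily.card_le_of_noncrossing`). -/

/-- The height at abscissa `x` of the line with slope `ℓ.1` and intercept `ℓ.2`. -/
def lineAt (ℓ : ℝ × ℝ) (x : ℝ) : ℝ := ℓ.1 * x + ℓ.2

theorem exists_lineAt_eq_of_lt_of_lt {f g : ℝ × ℝ} {m x : ℝ} (hmx : m < x)
    (hm : lineAt f m < lineAt g m) (hx : lineAt g x < lineAt f x) :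
    ∃ t, m < t ∧ t < x ∧ lineAt f t = lineAt g t := by
  unfold lineAt at *
  have hs : 0 < f.1 - g.1 := by
    by_contra! h
    nlinarith
  refine ⟨(g.2 - f.2) / (f.1 - g.1), ?_, ?_, ?_⟩
  · rw [lt_div_iff₀ hs]; linarith
  · rw [div_lt_iff₀ hs]; linarith
  · field_simp
    ring

theorem lineAt_lt_iff_of_eq {f g : ℝ × ℝ} {m x : ℝ} (hmx : m < x)
    (hm : lineAt f m = lineAt g m) : lineAt f x < lineAt g x ↔ f.1 < g.1 := by
  unfold lineAt at *
  constructor <;> intro h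
  · by_contra! h'
    nlinarith
  · nlinarith

theorem eq_of_lineAt_eq {f g : ℝ × ℝ} {x y : ℝ} (hxy : x ≠ y)
    (hx : lineAt f x = lineAt g x) (hy : lineAt f y = lineAt g y) : f = g := by
  unfold lineAt at *
  have h : (f.1 - g.1) * (x - y) = 0 := by linarith
  have h1 : f.1 = g.1 := by
    rcases mul_eq_zero.1 h with h | h
    · linarith
    · exact absurd (sub_eq_zero.1 h) hxy
  refine Prod.ext h1 ?_
  rw [h1] at hx
  linarith

theorem continuous_lineAt (f : ℝ × ℝ) : Continuous (lineAt f) := by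
  unfold lineAt; fun_prop

/-! ### Non-crossing families of segments. -/

/-- A family of non-vertical segments, indexed by `G`, with endpoints `l e`, `r e` (from left to
right) in the vertex set `V`, supporting lines `ℓ e`, and no vertex in the interior of a segment. -/
structure IsSegmentFamily {ι : Type*} (G : Finset ι) (V : Finset (ℝ × ℝ)) (l r ℓ : ι → ℝ × ℝ) :
    Prop where
  left_mem : ∀ e ∈ G, l e ∈ V
  right_mem : ∀ e ∈ G, r e ∈ V
  left_lt_right : ∀ e ∈ G, (l e).1 < (r e).1
  left_on : ∀ e ∈ G, lineAt (ℓ e) (l e).1 = (l e).2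
  right_on : ∀ e ∈ G, lineAt (ℓ e) (r e).1 = (r e).2
  interior_free : ∀ e ∈ G, ∀ v ∈ V, (l e).1 < v.1 → v.1 < (r e).1 → lineAt (ℓ e) v.1 ≠ v.2

/-- Two segments cross when they meet at a point interior to both. -/
def SegmentsCross {ι : Type*} (l r ℓ : ι → ℝ × ℝ) (e g : ι) : Prop :=
  ∃ x, (l e).1 < x ∧ x < (r e).1 ∧ (l g).1 < x ∧ x < (r g).1 ∧ lineAt (ℓ e) x = lineAt (ℓ g) x

/-- `e` and `e'` are consecutive segments leaving their common left endpoint to the right, and `w`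
is a leftmost vertex in the closed wedge between them. -/
structure IsWedge {ι : Type*} (G : Finset ι) (V : Finset (ℝ × ℝ)) (l r ℓ : ι → ℝ × ℝ)
    (e e' : ι) (w : ℝ × ℝ) : Prop where
  mem : e' ∈ G
  left_eq : l e' = l e
  slope_lt : (ℓ e).1 < (ℓ e').1
  consecutive : ∀ g ∈ G, l g = l e → (ℓ e).1 < (ℓ g).1 → ¬ (ℓ g).1 < (ℓ e').1
  lt : (l e).1 < w.1
  le_right : w.1 ≤ (r e).1
  le_right' : w.1 ≤ (r e').1
  le_apex : lineAt (ℓ e) w.1 ≤ w.2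
  apex_le : w.2 ≤ lineAt (ℓ e') w.1
  empty : ∀ z ∈ V, (l e).1 < z.1 → z.1 < w.1 → lineAt (ℓ e) z.1 ≤ z.2 →
    ¬ z.2 ≤ lineAt (ℓ e') z.1

namespace IsSegmentFamily

variable {ι : Type*} {G : Finset ι} {V : Finset (ℝ × ℝ)} {l r ℓ : ι → ℝ × ℝ}

theorem exists_isWedge (h : IsSegmentFamily G V l r ℓ) {e : ι} (he : e ∈ G)
    (htop : ∃ g ∈ G, l g = l e ∧ (ℓ e).1 < (ℓ g).1) :
    ∃ e' w, w ∈ V ∧ IsWedge G V l r ℓ e e' w := by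
  classical
  obtain ⟨e', he', hmin⟩ := (G.filter fun g => l g = l e ∧ (ℓ e).1 < (ℓ g).1).exists_min_image
    (fun g => (ℓ g).1) (by obtain ⟨g, hg, h1⟩ := htop; exact ⟨g, by simp [hg, h1]⟩)
  simp only [Finset.mem_filter] at he' hmin
  obtain ⟨heG, hle, hs⟩ := he'
  have hbase : lineAt (ℓ e) (l e).1 = lineAt (ℓ e') (l e).1 := by
    rw [h.left_on e he, ← hle, h.left_on e' heG]
  have hlt : ∀ x, (l e).1 < x → lineAt (ℓ e) x < lineAt (ℓ e') x := fun x hx =>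
    (lineAt_lt_iff_of_eq hx hbase).2 hs
  have h1 := h.left_lt_right e he
  have h2 := h.left_lt_right e' heG
  rw [hle] at h2
  obtain ⟨w, hw, hwmin⟩ := (V.filter fun z => (l e).1 < z.1 ∧ z.1 ≤ (r e).1 ∧ z.1 ≤ (r e').1 ∧
    lineAt (ℓ e) z.1 ≤ z.2 ∧ z.2 ≤ lineAt (ℓ e') z.1).exists_min_image (fun z => z.1) (by
      -- The right endpoint that comes first lies in the closed wedge, so there is a vertex to
      -- minimize over.
      rcases le_total (r e).1 (r e').1 with hc | hc
      · refine ⟨r e, ?_⟩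
        simp only [Finset.mem_filter]
        have := h.right_on e he
        have := hlt _ h1
        exact ⟨h.right_mem e he, h1, le_rfl, hc, by linarith, by linarith⟩
      · refine ⟨r e', ?_⟩
        simp only [Finset.mem_filter]
        have := h.right_on e' heG
        have := hlt _ h2
        exact ⟨h.right_mem e' heG, h2, hc, le_rfl, by linarith, by linarith⟩)
  simp only [Finset.mem_filter] at hw hwmin
  obtain ⟨hwV, hw1, hw2, hw3, hw4, hw5⟩ := hw
  refine ⟨e', w, hwV, heG, hle, hs, ?_, hw1, hw2, hw3, hw4, hw5, ?_⟩
  · intro g hg hg1 hg2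
    exact not_lt.2 (hmin g ⟨hg, hg1, hg2⟩)
  · intro z hz hz1 hz2 hz3 hz4
    have := hwmin z ⟨hz, hz1, by linarith, by linarith, hz3, hz4⟩
    linarith

/-- In a non-crossing family, no segment enters a wedge to the left of its first vertex. -/
theorem not_between (h : IsSegmentFamily G V l r ℓ)
    (hnc : ∀ e ∈ G, ∀ g ∈ G, e ≠ g → ¬ SegmentsCross l r ℓ e g)
    {e e' g : ι} {w : ℝ × ℝ} (he : e ∈ G) (hw : IsWedge G V l r ℓ e e' w) (hg : g ∈ G) {x : ℝ}
    (hex : (l e).1 < x) (hxw : x < w.1) (hgx : (l g).1 < x) (hxg : x < (r g).1)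
    (h1 : lineAt (ℓ e) x < lineAt (ℓ g) x) : ¬ lineAt (ℓ g) x < lineAt (ℓ e') x := by
  intro h2
  have hw1 := hw.le_right
  have hw2 := hw.le_right'
  have hle := hw.left_eq
  -- Followed leftwards from `x`, `g` cannot leave the wedge without crossing one of its sides.
  have key : ∀ m, (l e).1 ≤ m → (l g).1 ≤ m → m < x →
      lineAt (ℓ e) m ≤ lineAt (ℓ g) m ∧ lineAt (ℓ g) m ≤ lineAt (ℓ e') m := by
    intro m hm1 hm2 hm3
    constructor
    · by_contra! hlt
      obtain ⟨t, ht1, ht2, ht⟩ := exists_lineAt_eq_of_lt_of_lt hm3 hlt h1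
      refine hnc g hg e he ?_ ⟨t, ?_, ?_, ?_, ?_, ht⟩ <;> try linarith
      rintro rfl
      exact lt_irrefl _ h1
    · by_contra! hlt
      obtain ⟨t, ht1, ht2, ht⟩ := exists_lineAt_eq_of_lt_of_lt hm3 hlt h2
      refine hnc e' hw.mem g hg ?_ ⟨t, ?_, ?_, ?_, ?_, ht⟩ <;> (try rw [hle]) <;> try linarith
      rintro rfl
      exact lt_irrefl _ h2
  -- Either `g` starts inside the wedge, left of `w`, or it reaches the apex. In the latter case the
  -- apex is interior to `g`, or `g` starts there with a slope strictly between two consecutive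
  -- ones.
  rcases lt_or_ge (l e).1 (l g).1 with hc | hc
  · obtain ⟨k1, k2⟩ := key _ hc.le le_rfl hgx
    rw [h.left_on g hg] at k1 k2
    exact hw.empty _ (h.left_mem g hg) hc (by linarith) k1 k2
  · obtain ⟨k1, k2⟩ := key _ le_rfl hc hex
    have e1 : lineAt (ℓ e) (l e).1 = (l e).2 := h.left_on e he
    have e2 : lineAt (ℓ e') (l e).1 = (l e).2 := by rw [← hle]; exact h.left_on e' hw.mem
    have e3 : lineAt (ℓ g) (l e).1 = (l e).2 := by linarith
    rcases hc.lt_or_eq with hc | hc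
    · exact h.interior_free g hg _ (h.left_mem e he) hc (by linarith) e3
    · have hlg : l g = l e := Prod.ext hc (by rw [← h.left_on g hg, hc, e3])
      exact hw.consecutive g hg hlg ((lineAt_lt_iff_of_eq hex (e1.trans e3.symm)).1 h1)
        ((lineAt_lt_iff_of_eq hex (e3.trans e2.symm)).1 h2)

/-- Slightly left of `w` the vertical sections of the two wedges still overlap. If the lower sides
differ there, the higher one runs inside the other wedge, against `not_between`; if they agree,
distinct lower sides would cross. -/
theorem eq_of_isWedge (h : IsSegmentFamily G V l r ℓ)
    (hnc : ∀ e ∈ G, ∀ g ∈ G, e ≠ g → ¬ SegmentsCross l r ℓ e g)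
    {e e' g g' : ι} {w : ℝ × ℝ} (he : e ∈ G) (hg : g ∈ G)
    (hwe : IsWedge G V l r ℓ e e' w) (hwg : IsWedge G V l r ℓ g g' w)
    (h1 : lineAt (ℓ e) w.1 < lineAt (ℓ g') w.1) (h2 : lineAt (ℓ g) w.1 < lineAt (ℓ e') w.1) :
    e = g := by
  have ev1 := ((continuous_lineAt (ℓ e)).tendsto w.1).eventually_lt
    ((continuous_lineAt (ℓ g')).tendsto w.1) h1
  have ev2 := ((continuous_lineAt (ℓ g)).tendsto w.1).eventually_lt
    ((continuous_lineAt (ℓ e')).tendsto w.1) h2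
  have ev3 := lt_mem_nhds hwe.lt
  have ev4 := lt_mem_nhds hwg.lt
  obtain ⟨x, ⟨⟨⟨x1, x2⟩, x3⟩, x4⟩, x5⟩ :=
    ((((ev1.and ev2).and ev3).and ev4).filter_mono nhdsWithin_le_nhds |>.and
      (self_mem_nhdsWithin : Set.Iio w.1 ∈ nhdsWithin w.1 (Set.Iio w.1))).exists
  have x5 : x < w.1 := x5
  have hw1 := hwe.le_right
  have hw2 := hwg.le_right
  by_contra hne
  rcases lt_trichotomy (lineAt (ℓ e) x) (lineAt (ℓ g) x) with hc | hc | hc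
  · exact h.not_between hnc he hwe hg x3 x5 x4 (by linarith) hc x2
  · exact hnc e he g hg hne ⟨x, x3, by linarith, x4, by linarith, hc⟩
  · exact h.not_between hnc hg hwg he x4 x5 x3 (by linarith) hc x1

/-- A non-crossing family of segments has at most three times as many segments as vertices. -/
theorem card_le_of_noncrossing (h : IsSegmentFamily G V l r ℓ)
    (hnc : ∀ e ∈ G, ∀ g ∈ G, e ≠ g → ¬ SegmentsCross l r ℓ e g) : G.card ≤ 3 * V.card := by
  classical
  -- `A` holds the steepest segment at each left endpoint. Any other segment bounds a wedge from
  -- below and is charged to its vertex `w`, which lies strictly below the upper side (`B`) or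
  -- strictly above the lower side (`D`). Each class charges a vertex at most once, whence the
  -- factor 3.
  let A := G.filter fun e => ¬ ∃ g ∈ G, l g = l e ∧ (ℓ e).1 < (ℓ g).1
  let B := G.filter fun e => ∃ e' w, w ∈ V ∧ IsWedge G V l r ℓ e e' w ∧ w.2 < lineAt (ℓ e') w.1
  let D := G.filter fun e => ∃ e' w, w ∈ V ∧ IsWedge G V l r ℓ e e' w ∧ lineAt (ℓ e) w.1 < w.2
  have hA : A.card ≤ V.card := by
    refine Finset.card_le_card_of_injOn l (fun e he => h.left_mem e (Finset.mem_filter.1 he).1) ?_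
    intro e he g hg heg
    obtain ⟨he, he1⟩ := Finset.mem_filter.1 (Finset.mem_coe.1 he)
    obtain ⟨hg, hg1⟩ := Finset.mem_filter.1 (Finset.mem_coe.1 hg)
    push Not at he1 hg1
    have hs : (ℓ e).1 = (ℓ g).1 := le_antisymm (hg1 e he heg) (he1 g hg heg.symm)
    have h1 := h.left_on e he
    have h2 := h.left_on g hg
    have h3 := h.left_lt_right e he
    have h4 := h.left_lt_right g hg
    -- Same slope and same left endpoint: the segments overlap, which counts as crossing.
    by_contra hne
    obtain ⟨x, hx1, hx2⟩ := exists_between (lt_min h3 (heg ▸ h4))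
    obtain ⟨hx2, hx3⟩ := lt_min_iff.1 hx2
    refine hnc e he g hg hne ⟨x, hx1, hx2, heg ▸ hx1, hx3, ?_⟩
    rw [heg] at h1
    unfold lineAt at *
    rw [hs] at *
    linarith
  have hB : B.card ≤ V.card := by
    refine Finset.card_le_card_of_forall_subsingleton
      (fun e w => ∃ e', IsWedge G V l r ℓ e e' w ∧ w.2 < lineAt (ℓ e') w.1) ?_ ?_
    · intro e he
      obtain ⟨-, e', w, hw, h1⟩ := Finset.mem_filter.1 he
      exact ⟨w, hw, e', h1⟩
    · rintro w - e ⟨he, e', hwe, h1⟩ g ⟨hg, g', hwg, h2⟩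
      have he := (Finset.mem_filter.1 he).1
      have hg := (Finset.mem_filter.1 hg).1
      exact h.eq_of_isWedge hnc he hg hwe hwg (hwe.le_apex.trans_lt h2) (hwg.le_apex.trans_lt h1)
  have hD : D.card ≤ V.card := by
    refine Finset.card_le_card_of_forall_subsingleton
      (fun e w => ∃ e', IsWedge G V l r ℓ e e' w ∧ lineAt (ℓ e) w.1 < w.2) ?_ ?_
    · intro e he
      obtain ⟨-, e', w, hw, h1⟩ := Finset.mem_filter.1 he
      exact ⟨w, hw, e', h1⟩
    · rintro w - e ⟨he, e', hwe, h1⟩ g ⟨hg, g', hwg, h2⟩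
      have he := (Finset.mem_filter.1 he).1
      have hg := (Finset.mem_filter.1 hg).1
      exact h.eq_of_isWedge hnc he hg hwe hwg (h1.trans_le hwg.apex_le) (h2.trans_le hwe.apex_le)
  have hsub : G ⊆ A ∪ (B ∪ D) := by
    intro e he
    simp only [A, B, D, Finset.mem_union, Finset.mem_filter, he, true_and]
    by_cases htop : ∃ g ∈ G, l g = l e ∧ (ℓ e).1 < (ℓ g).1
    · right
      obtain ⟨e', w, hw, hwe⟩ := h.exists_isWedge he htop
      have hlt : lineAt (ℓ e) w.1 < lineAt (ℓ e') w.1 := by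
        refine (lineAt_lt_iff_of_eq hwe.lt ?_).2 hwe.slope_lt
        rw [h.left_on e he, ← hwe.left_eq, h.left_on e' hwe.mem]
      rcases lt_or_ge w.2 (lineAt (ℓ e') w.1) with hc | hc
      · exact Or.inl ⟨e', w, hw, hwe, hc⟩
      · exact Or.inr ⟨e', w, hw, hwe, hlt.trans_le hc⟩
    · exact Or.inl htop
  have := Finset.card_le_card hsub
  have := Finset.card_union_le A (B ∪ D)
  have := Finset.card_union_le B D
  omega

end IsSegmentFamily

/-! ### Random sampling and the crossing inequality. -/

/-- In a random subset of `V` with independent inclusion probability `p`, the expected number of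
indices `t ∈ T` whose set `A t` is included equals `∑ t ∈ T, p ^ #(A t)`. -/
theorem sum_powerset_weight_mul_card {α τ : Type*} [DecidableEq α] (V : Finset α) (T : Finset τ)
    (A : τ → Finset α) (hA : ∀ t ∈ T, A t ⊆ V) (p : ℝ) :
    ∑ S ∈ V.powerset, p ^ S.card * (1 - p) ^ (V.card - S.card) *
      ((T.filter fun t => A t ⊆ S).card : ℝ) = ∑ t ∈ T, p ^ (A t).card := by
  have hone : ∀ t ∈ T, ∑ S ∈ V.powerset with A t ⊆ S,
      p ^ S.card * (1 - p) ^ (V.card - S.card) = p ^ (A t).card := by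
    intro t ht
    have hAV := hA t ht
    -- The binomial theorem on `V \ A t`: the vertices outside `A t` are sampled freely, with total
    -- weight 1.
    have : p ^ (A t).card = ∑ S ∈ (V \ A t).powerset,
        p ^ (A t).card * (p ^ S.card * (1 - p) ^ ((V \ A t).card - S.card)) := by
      rw [← Finset.mul_sum, Finset.sum_pow_mul_eq_add_pow]
      simp
    rw [this]
    symm
    refine Finset.sum_bij' (fun S _ => A t ∪ S) (fun S _ => S \ A t) ?_ ?_ ?_ ?_ ?_
    · intro S hS
      simp only [Finset.mem_filter, Finset.mem_powerset] at hS ⊢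
      exact ⟨Finset.union_subset hAV (hS.trans Finset.sdiff_subset), Finset.subset_union_left⟩
    · intro S hS
      simp only [Finset.mem_filter, Finset.mem_powerset] at hS ⊢
      exact Finset.sdiff_subset_sdiff hS.1 le_rfl
    · intro S hS
      simp only [Finset.mem_powerset] at hS
      exact Finset.union_sdiff_cancel_left (Finset.disjoint_of_subset_right hS
        Finset.disjoint_sdiff)
    · intro S hS
      simp only [Finset.mem_filter] at hS
      exact Finset.union_sdiff_of_subset hS.2
    · intro S hS
      simp only [Finset.mem_powerset] at hS
      have hd : Disjoint (A t) S := Finset.disjoint_of_subset_right hS Finset.disjoint_sdiff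
      rw [Finset.card_union_of_disjoint hd, Finset.card_sdiff_of_subset hAV, pow_add,
        Nat.sub_sub, mul_assoc]
  rw [← Finset.sum_congr rfl hone]
  simp only [Finset.card_filter, Finset.sum_filter, Nat.cast_sum, Nat.cast_ite, Nat.cast_one,
    Nat.cast_zero, Finset.mul_sum, mul_ite, mul_one, mul_zero]
  exact Finset.sum_comm

open Classical in
/-- The ordered pairs of distinct crossing segments. -/
noncomputable def crossingPairs {ι : Type*} (G : Finset ι) (l r ℓ : ι → ℝ × ℝ) : Finset (ι × ι) :=
  (G ×ˢ G).filter fun t => t.1 ≠ t.2 ∧ SegmentsCross l r ℓ t.1 t.2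

namespace IsSegmentFamily

variable {ι : Type*} {G : Finset ι} {V : Finset (ℝ × ℝ)} {l r ℓ : ι → ℝ × ℝ}

theorem mono (h : IsSegmentFamily G V l r ℓ) {H : Finset ι} {S : Finset (ℝ × ℝ)} (hH : H ⊆ G)
    (hS : S ⊆ V) (hl : ∀ e ∈ H, l e ∈ S) (hr : ∀ e ∈ H, r e ∈ S) : IsSegmentFamily H S l r ℓ where
  left_mem := hl
  right_mem := hr
  left_lt_right e he := h.left_lt_right e (hH he)
  left_on e he := h.left_on e (hH he)
  right_on e he := h.right_on e (hH he)
  interior_free e he v hv := h.interior_free e (hH he) v (hS hv)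

/-- Deleting the first member of every crossing pair leaves a non-crossing family. -/
theorem card_le_add_crossingPairs (h : IsSegmentFamily G V l r ℓ) :
    G.card ≤ 3 * V.card + (crossingPairs G l r ℓ).card := by
  classical
  let H := G \ (crossingPairs G l r ℓ).image Prod.fst
  have hH : H ⊆ G := Finset.sdiff_subset
  have h1 : H.card ≤ 3 * V.card := by
    refine (h.mono hH le_rfl (fun e he => h.left_mem e (hH he))
      (fun e he => h.right_mem e (hH he))).card_le_of_noncrossing ?_
    intro e he g hg hne hc
    refine (Finset.mem_sdiff.1 he).2 (Finset.mem_image.2 ⟨(e, g), ?_, rfl⟩)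
    simp only [crossingPairs, Finset.mem_filter, Finset.mem_product]
    exact ⟨⟨hH he, hH hg⟩, hne, hc⟩
  have h2 : G.card ≤ H.card + ((crossingPairs G l r ℓ).image Prod.fst).card := by
    have : _ ≤ H.card := Finset.le_card_sdiff ((crossingPairs G l r ℓ).image Prod.fst) G
    omega
  have h3 : ((crossingPairs G l r ℓ).image Prod.fst).card ≤ _ := Finset.card_image_le
  omega

/-- The crossing inequality, before optimizing the sampling probability `p`. -/
theorem sq_mul_card_le (h : IsSegmentFamily G V l r ℓ)
    (hX : ∀ t ∈ crossingPairs G l r ℓ, ({l t.1, r t.1, l t.2, r t.2} : Finset (ℝ × ℝ)).card = 4)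
    {p : ℝ} (hp0 : 0 ≤ p) (hp1 : p ≤ 1) :
    p ^ 2 * G.card ≤ 3 * (p * V.card) + p ^ 4 * (crossingPairs G l r ℓ).card := by
  classical
  set X := crossingPairs G l r ℓ with hXdef
  have hXG : ∀ t ∈ X, t.1 ∈ G ∧ t.2 ∈ G := fun t ht =>
    Finset.mem_product.1 (Finset.mem_filter.1 ht).1
  -- The weak bound holds for the segments with both endpoints in a sample `S`. Averaging over `S`
  -- scales segments, vertices and crossings by $p^2$, $p$ and $p^4$, the last because `hX` gives
  -- four distinct endpoints.
  have hS : ∀ S ∈ V.powerset, ((G.filter fun e => ({l e, r e} : Finset (ℝ × ℝ)) ⊆ S).card : ℝ) ≤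
      3 * ((V.filter fun v => ({v} : Finset (ℝ × ℝ)) ⊆ S).card : ℝ) +
        ((X.filter fun t => ({l t.1, r t.1, l t.2, r t.2} : Finset (ℝ × ℝ)) ⊆ S).card : ℝ) := by
    intro S hS
    have hSV := Finset.mem_powerset.1 hS
    have hfam : IsSegmentFamily (G.filter fun e => ({l e, r e} : Finset (ℝ × ℝ)) ⊆ S) S l r ℓ :=
      h.mono (Finset.filter_subset _ _) hSV
        (fun e he => (Finset.mem_filter.1 he).2 (by simp))
        (fun e he => (Finset.mem_filter.1 he).2 (by simp))
    have h1 := hfam.card_le_add_crossingPairs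
    have h2 : (V.filter fun v => ({v} : Finset (ℝ × ℝ)) ⊆ S) = S := by
      ext v
      simp only [Finset.mem_filter, Finset.singleton_subset_iff]
      exact ⟨fun h => h.2, fun h => ⟨hSV h, h⟩⟩
    have h3 : crossingPairs (G.filter fun e => ({l e, r e} : Finset (ℝ × ℝ)) ⊆ S) l r ℓ ⊆
        X.filter fun t => ({l t.1, r t.1, l t.2, r t.2} : Finset (ℝ × ℝ)) ⊆ S := by
      intro t ht
      simp only [hXdef, crossingPairs, Finset.mem_filter, Finset.mem_product,
        Finset.insert_subset_iff, Finset.singleton_subset_iff] at ht ⊢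
      tauto
    have h4 := Finset.card_le_card h3
    rw [h2]
    exact_mod_cast h1.trans (by omega)
  have hsum := Finset.sum_le_sum fun S hSV => mul_le_mul_of_nonneg_left (hS S hSV)
    (show 0 ≤ p ^ S.card * (1 - p) ^ (V.card - S.card) from
      mul_nonneg (pow_nonneg hp0 _) (pow_nonneg (by linarith) _))
  simp only [mul_add, mul_left_comm _ (3 : ℝ), Finset.sum_add_distrib, ← Finset.mul_sum] at hsum
  rw [sum_powerset_weight_mul_card V G, sum_powerset_weight_mul_card V V,
    sum_powerset_weight_mul_card V X] at hsum
  · have e1 : ∑ e ∈ G, p ^ ({l e, r e} : Finset (ℝ × ℝ)).card = p ^ 2 * G.card := by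
      rw [Finset.sum_congr rfl (g := fun _ => p ^ 2), Finset.sum_const, nsmul_eq_mul, mul_comm]
      intro e he
      rw [Finset.card_pair]
      intro heq
      exact (h.left_lt_right e he).ne (congrArg Prod.fst heq)
    have e2 : ∑ t ∈ X, p ^ ({l t.1, r t.1, l t.2, r t.2} : Finset (ℝ × ℝ)).card
        = p ^ 4 * X.card := by
      rw [Finset.sum_congr rfl (g := fun _ => p ^ 4), Finset.sum_const, nsmul_eq_mul, mul_comm]
      intro t ht
      rw [hX t ht]
    rw [e1, e2] at hsum
    simpa [mul_comm p] using hsum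
  · intro t ht
    obtain ⟨h1, h2⟩ := hXG t ht
    simp [Finset.insert_subset_iff, h.left_mem _ h1, h.left_mem _ h2, h.right_mem _ h1,
      h.right_mem _ h2]
  · intro v hv
    simpa using hv
  · intro e he
    simp [Finset.insert_subset_iff, h.left_mem _ he, h.right_mem _ he]

end IsSegmentFamily

/-! ### Point-line incidences. -/

open Classical in
/-- The incidences between a set of points and a set of non-vertical lines. -/
noncomputable def incidences (P L : Finset (ℝ × ℝ)) : Finset ((ℝ × ℝ) × (ℝ × ℝ)) :=
  (P ×ˢ L).filter fun t => lineAt t.2 t.1.1 = t.1.2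

theorem mem_incidences {P L : Finset (ℝ × ℝ)} {t : (ℝ × ℝ) × (ℝ × ℝ)} :
    t ∈ incidences P L ↔ (t.1 ∈ P ∧ t.2 ∈ L) ∧ lineAt t.2 t.1.1 = t.1.2 := by
  simp [incidences]

/-- The segments between consecutive points on the lines of an arrangement. -/
theorem exists_isSegmentFamily (P L : Finset (ℝ × ℝ)) :
    ∃ (G : Finset ((ℝ × ℝ) × (ℝ × ℝ))) (r : (ℝ × ℝ) × (ℝ × ℝ) → ℝ × ℝ), G ⊆ incidences P L ∧
      (incidences P L).card ≤ G.card + L.card ∧ IsSegmentFamily G P Prod.fst r Prod.snd := by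
  classical
  -- An incidence stands for the segment to the next point on its line; only the rightmost incidence
  -- of each line is lost.
  let G := (incidences P L).filter fun t => ∃ q ∈ P, lineAt t.2 q.1 = q.2 ∧ t.1.1 < q.1
  have hnext : ∀ t : (ℝ × ℝ) × (ℝ × ℝ), ∃ q : ℝ × ℝ, t ∈ G → q ∈ P ∧ lineAt t.2 q.1 = q.2 ∧
      t.1.1 < q.1 ∧ ∀ z ∈ P, t.1.1 < z.1 → lineAt t.2 z.1 = z.2 → q.1 ≤ z.1 := by
    intro t
    by_cases ht : t ∈ G
    · obtain ⟨-, q, hq, h1, h2⟩ := Finset.mem_filter.1 ht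
      obtain ⟨w, hw, hmin⟩ := (P.filter fun z => t.1.1 < z.1 ∧ lineAt t.2 z.1 = z.2)
        |>.exists_min_image (fun z => z.1) ⟨q, by simp [hq, h1, h2]⟩
      simp only [Finset.mem_filter] at hw hmin
      exact ⟨w, fun _ => ⟨hw.1, hw.2.2, hw.2.1, fun z hz h1 h2 => hmin z ⟨hz, h1, h2⟩⟩⟩
    · exact ⟨0, fun h => absurd h ht⟩
  choose r hr using hnext
  refine ⟨G, r, Finset.filter_subset _ _, ?_, ?_⟩
  · have h1 : (incidences P L \ G).card ≤ L.card := by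
      refine Finset.card_le_card_of_injOn Prod.snd ?_ ?_
      · intro t ht
        exact (mem_incidences.1 (Finset.mem_sdiff.1 ht).1).1.2
      · intro t ht s hs hts
        simp only [G, Finset.coe_sdiff, Set.mem_sdiff, Finset.mem_coe, Finset.mem_filter, not_and,
          not_exists] at ht hs
        have h1 := mem_incidences.1 ht.1
        have h2 := mem_incidences.1 hs.1
        have h3 := ht.2 ht.1 s.1 h2.1.1 (hts ▸ h2.2)
        have h4 := hs.2 hs.1 t.1 h1.1.1 (hts ▸ h1.2)
        have h5 : t.1.1 = s.1.1 := le_antisymm (not_lt.1 h4) (not_lt.1 h3)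
        refine Prod.ext (Prod.ext h5 ?_) hts
        rw [← h1.2, ← h2.2, hts, h5]
    have := Finset.le_card_sdiff G (incidences P L)
    omega
  · have hG : ∀ t ∈ G, _ := fun t ht => mem_incidences.1 (Finset.filter_subset _ _ ht)
    exact ⟨fun t ht => (hG t ht).1.1, fun t ht => (hr t ht).1, fun t ht => (hr t ht).2.2.1,
      fun t ht => (hG t ht).2, fun t ht => (hr t ht).2.1,
      fun t ht v hv h1 h2 h3 => absurd ((hr t ht).2.2.2 v hv h1 h3) (not_le.2 h2)⟩

/-- If the left endpoints differed, the one further right would be a vertex interior to the other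
segment. -/
theorem IsSegmentFamily.eq_of_overlap {G : Finset ((ℝ × ℝ) × (ℝ × ℝ))} {P : Finset (ℝ × ℝ)}
    {r : (ℝ × ℝ) × (ℝ × ℝ) → ℝ × ℝ} (h : IsSegmentFamily G P Prod.fst r Prod.snd)
    {e g : (ℝ × ℝ) × (ℝ × ℝ)} (he : e ∈ G) (hg : g ∈ G) (heg : e.2 = g.2) {x : ℝ}
    (he1 : e.1.1 < x) (he2 : x < (r e).1) (hg1 : g.1.1 < x) (hg2 : x < (r g).1) : e = g := by
  have e1 := h.left_on e he
  have g1 := h.left_on g hg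
  rcases lt_trichotomy e.1.1 g.1.1 with hc | hc | hc
  · exact absurd (heg ▸ g1) (h.interior_free e he g.1 (h.left_mem g hg) hc (by linarith))
  · refine Prod.ext (Prod.ext hc ?_) heg
    rw [← e1, ← g1, heg, hc]
  · exact absurd (heg ▸ e1) (h.interior_free g hg e.1 (h.left_mem e he) hc (by linarith))

/-- An incidence bound of Szemerédi–Trotter type, with a free parameter `p`. -/
theorem sq_mul_card_incidences_le (P L : Finset (ℝ × ℝ)) {p : ℝ} (hp0 : 0 ≤ p) (hp1 : p ≤ 1) :
    p ^ 2 * (incidences P L).card ≤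
      p ^ 2 * L.card + 3 * (p * P.card) + p ^ 4 * (L.card : ℝ) ^ 2 := by
  classical
  obtain ⟨G, r, hGI, hcard, h⟩ := exists_isSegmentFamily P L
  have hX : ∀ t ∈ crossingPairs G Prod.fst r Prod.snd, t.1 ∈ G ∧ t.2 ∈ G ∧ t.1 ≠ t.2 ∧
      SegmentsCross Prod.fst r Prod.snd t.1 t.2 := by
    intro t ht
    simpa [crossingPairs, and_assoc] using ht
  have hline : ∀ t ∈ crossingPairs G Prod.fst r Prod.snd, t.1.2 ≠ t.2.2 := by
    intro t ht heq
    obtain ⟨h1, h2, hne, x, x1, x2, x3, x4, -⟩ := hX t ht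
    exact hne (h.eq_of_overlap h1 h2 heq x1 x2 x3 x4)
  have h4 : ∀ t ∈ crossingPairs G Prod.fst r Prod.snd,
      ({t.1.1, r t.1, t.2.1, r t.2} : Finset (ℝ × ℝ)).card = 4 := by
    intro t ht
    obtain ⟨h1, h2, -, x, x1, x2, x3, x4, x5⟩ := hX t ht
    -- A shared endpoint would be a second common point of two distinct lines already meeting at
    -- `x`.
    have key : ∀ u : ℝ × ℝ, lineAt t.1.2 u.1 = u.2 → u.1 ≠ x → ¬ lineAt t.2.2 u.1 = u.2 :=
      fun u hu hux hu' => hline t ht (eq_of_lineAt_eq hux (hu.trans hu'.symm) x5)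
    have ne1 : t.1.1 ≠ r t.1 := fun h' => (h.left_lt_right _ h1).ne (congrArg Prod.fst h')
    have ne2 : t.2.1 ≠ r t.2 := fun h' => (h.left_lt_right _ h2).ne (congrArg Prod.fst h')
    have k1 := key _ (h.left_on _ h1) x1.ne
    have k2 := key _ (h.right_on _ h1) x2.ne'
    have l2 := h.left_on _ h2
    have r2 := h.right_on _ h2
    have n1 : t.1.1 ≠ t.2.1 := fun h' => k1 (h' ▸ l2)
    have n2 : t.1.1 ≠ r t.2 := fun h' => k1 (h' ▸ r2)
    have n3 : r t.1 ≠ t.2.1 := fun h' => k2 (h' ▸ l2)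
    have n4 : r t.1 ≠ r t.2 := fun h' => k2 (h' ▸ r2)
    rw [Finset.card_insert_of_notMem, Finset.card_insert_of_notMem, Finset.card_pair ne2]
    · simp [n3, n4]
    · simp [ne1, n1, n2]
  -- Two distinct lines meet at one abscissa, and that abscissa selects the segment on each line.
  have hXcard : (crossingPairs G Prod.fst r Prod.snd).card ≤ L.card ^ 2 := by
    rw [sq, ← Finset.card_product]
    refine Finset.card_le_card_of_injOn (fun t => (t.1.2, t.2.2)) ?_ ?_
    · intro t ht
      obtain ⟨h1, h2, -⟩ := hX t ht
      exact Finset.mem_coe.2 (Finset.mem_product.2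
        ⟨(mem_incidences.1 (hGI h1)).1.2, (mem_incidences.1 (hGI h2)).1.2⟩)
    · intro t ht s hs hts
      obtain ⟨h1, h2, -, x, x1, x2, x3, x4, x5⟩ := hX t ht
      obtain ⟨h1', h2', -, y, y1, y2, y3, y4, y5⟩ := hX s hs
      obtain ⟨e1, e2⟩ := Prod.mk.inj hts
      have hxy : x = y := by
        by_contra hxy
        exact hline t ht (eq_of_lineAt_eq hxy x5 (by rw [e1, e2]; exact y5))
      subst hxy
      exact Prod.ext (h.eq_of_overlap h1 h1' e1 x1 x2 y1 y2)
        (h.eq_of_overlap h2 h2' e2 x3 x4 y3 y4)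
  have hmain := h.sq_mul_card_le h4 hp0 hp1
  have c1 : ((incidences P L).card : ℝ) ≤ G.card + L.card := by exact_mod_cast hcard
  have c2 : ((crossingPairs G Prod.fst r Prod.snd).card : ℝ) ≤ (L.card : ℝ) ^ 2 := by
    exact_mod_cast hXcard
  have d1 := mul_le_mul_of_nonneg_left c1 (pow_nonneg hp0 2)
  have d2 := mul_le_mul_of_nonneg_left c2 (pow_nonneg hp0 4)
  linarith

/-- The Szemerédi–Trotter bound in the balanced case. -/
theorem card_incidences_le {P L : Finset (ℝ × ℝ)} {n : ℕ} (hP : P.card ≤ n) (hL : L.card ≤ n) :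
    ((incidences P L).card : ℝ) ≤ 5 * (n : ℝ) ^ (4 / 3 : ℝ) := by
  rcases Nat.eq_zero_or_pos n with rfl | hn
  · have : P = ∅ := Finset.card_eq_zero.1 (by omega)
    subst this
    simp [incidences]
  have hn1 : (1 : ℝ) ≤ n := by exact_mod_cast hn
  have hn0 : (0 : ℝ) < n := by linarith
  set q : ℝ := (n : ℝ) ^ (1 / 3 : ℝ) with hq
  have hq1 : 1 ≤ q := Real.one_le_rpow hn1 (by norm_num)
  have hq0 : 0 < q := by linarith
  have hq3 : q ^ 3 = n := by
    rw [hq, ← Real.rpow_natCast, ← Real.rpow_mul hn0.le]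
    norm_num
  have hq4 : (n : ℝ) ^ (4 / 3 : ℝ) = q ^ 4 := by
    rw [hq, ← Real.rpow_natCast, ← Real.rpow_mul hn0.le]
    norm_num
  -- The choice $p=n^{-1/3}$ balances the last two terms, giving $q^3+3q^4+q^4\le 5q^4$.
  have h := sq_mul_card_incidences_le P L (inv_nonneg.2 hq0.le) (inv_le_one_of_one_le₀ hq1)
  have hP' : (P.card : ℝ) ≤ q ^ 3 := by rw [hq3]; exact_mod_cast hP
  have hL' : (L.card : ℝ) ≤ q ^ 3 := by rw [hq3]; exact_mod_cast hL
  rw [hq4]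
  have h' := mul_le_mul_of_nonneg_left h (sq_nonneg q)
  have e1 : q ^ 2 * (q⁻¹ ^ 2 * ((incidences P L).card : ℝ)) = (incidences P L).card := by
    field_simp
  have e2 : q ^ 2 * (q⁻¹ ^ 2 * (L.card : ℝ) + 3 * (q⁻¹ * P.card) + q⁻¹ ^ 4 * (L.card : ℝ) ^ 2) =
      L.card + 3 * (q * P.card) + ((L.card : ℝ) / q) ^ 2 := by
    field_simp
  rw [e1, e2] at h'
  have f1 : q ^ 3 ≤ q ^ 4 := pow_le_pow_right₀ hq1 (by norm_num)
  have f2 : q * P.card ≤ q ^ 4 := by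
    have := mul_le_mul_of_nonneg_left hP' hq0.le
    linarith [show q * q ^ 3 = q ^ 4 by ring]
  have f3 : ((L.card : ℝ) / q) ^ 2 ≤ q ^ 4 := by
    have : (L.card : ℝ) / q ≤ q ^ 2 := by
      rw [div_le_iff₀ hq0]
      linarith [show q ^ 2 * q = q ^ 3 by ring]
    calc ((L.card : ℝ) / q) ^ 2 ≤ (q ^ 2) ^ 2 := pow_le_pow_left₀ (by positivity) this 2
      _ = q ^ 4 := by ring
  linarith

/-! ### Pairs with a prescribed dot product. -/

theorem EuclideanSpace.inner_fin_two (x y : EuclideanSpace ℝ (Fin 2)) :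
    inner ℝ x y = x 0 * y 0 + x 1 * y 1 := by
  simp [PiLp.inner_apply, Fin.sum_univ_two, mul_comm]

theorem EuclideanSpace.ext_fin_two {x y : EuclideanSpace ℝ (Fin 2)} (h0 : x 0 = y 0)
    (h1 : x 1 = y 1) : x = y := by
  ext i
  fin_cases i
  · exact h0
  · exact h1

open Classical in
/-- The ordered pairs of points of `E` with dot product `a`. -/
noncomputable def dotPairs (a : ℝ) (E : Finset (EuclideanSpace ℝ (Fin 2))) :
    Finset (EuclideanSpace ℝ (Fin 2) × EuclideanSpace ℝ (Fin 2)) :=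
  (E ×ˢ E).filter fun t => inner ℝ t.1 t.2 = a

theorem mem_dotPairs {a : ℝ} {E : Finset (EuclideanSpace ℝ (Fin 2))}
    {t : EuclideanSpace ℝ (Fin 2) × EuclideanSpace ℝ (Fin 2)} :
    t ∈ dotPairs a E ↔ (t.1 ∈ E ∧ t.2 ∈ E) ∧ inner ℝ t.1 t.2 = a := by
  simp [dotPairs]

/-- Each `y` with `y 1 ≠ 0` gives a non-vertical line $x\cdot y=a$, and `a ≠ 0` lets the line
determine `y`. The remaining `y` give vertical lines, at most one through each `x`; these add `n` to
the incidence bound, turning 5 into 6. -/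
theorem card_dotPairs_le {a : ℝ} (ha : a ≠ 0) (E : Finset (EuclideanSpace ℝ (Fin 2))) :
    ((dotPairs a E).card : ℝ) ≤ 6 * (E.card : ℝ) ^ (4 / 3 : ℝ) := by
  classical
  let P : Finset (ℝ × ℝ) := E.image fun x => (x 0, x 1)
  -- Points with `y 1 = 0` contribute the harmless line `(0, 0)`, since division by zero yields 0.
  let L : Finset (ℝ × ℝ) := E.image fun y => (-y 0 / y 1, a / y 1)
  have hI := card_incidences_le (P := P) (L := L) (n := E.card) Finset.card_image_le
    Finset.card_image_le
  have h1 : ((dotPairs a E).filter fun t => t.2 1 ≠ 0).card ≤ (incidences P L).card := by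
    refine Finset.card_le_card_of_injOn
      (fun t => ((t.1 0, t.1 1), (-t.2 0 / t.2 1, a / t.2 1))) ?_ ?_
    · intro t ht
      obtain ⟨ht, hne⟩ := Finset.mem_filter.1 ht
      obtain ⟨⟨hx, hy⟩, hxy⟩ := mem_dotPairs.1 ht
      rw [EuclideanSpace.inner_fin_two] at hxy
      refine Finset.mem_coe.2 (mem_incidences.2 ⟨⟨Finset.mem_image.2 ⟨_, hx, rfl⟩,
        Finset.mem_image.2 ⟨_, hy, rfl⟩⟩, ?_⟩)
      simp only [lineAt]
      field_simp
      linarith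
    · intro t ht s hs hts
      have ht := (Finset.mem_filter.1 (Finset.mem_coe.1 ht)).2
      have hs := (Finset.mem_filter.1 (Finset.mem_coe.1 hs)).2
      simp only [Prod.mk.injEq] at hts
      obtain ⟨⟨e1, e2⟩, e3, e4⟩ := hts
      have e5 : t.2 1 = s.2 1 := by
        rw [div_eq_div_iff ht hs] at e4
        exact (mul_left_cancel₀ ha e4).symm
      rw [e5, div_left_inj' hs, neg_inj] at e3
      exact Prod.ext (EuclideanSpace.ext_fin_two e1 e2) (EuclideanSpace.ext_fin_two e3 e5)
  have h2 : ((dotPairs a E).filter fun t => ¬ t.2 1 ≠ 0).card ≤ E.card := by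
    refine Finset.card_le_card_of_injOn Prod.fst
      (fun t ht => (mem_dotPairs.1 (Finset.mem_filter.1 ht).1).1.1) ?_
    intro t ht s hs hts
    obtain ⟨ht, ht1⟩ := Finset.mem_filter.1 (Finset.mem_coe.1 ht)
    obtain ⟨hs, hs1⟩ := Finset.mem_filter.1 (Finset.mem_coe.1 hs)
    rw [not_not] at ht1 hs1
    have ht2 := (mem_dotPairs.1 ht).2
    have hs2 := (mem_dotPairs.1 hs).2
    rw [EuclideanSpace.inner_fin_two] at ht2 hs2
    rw [ht1, mul_zero, add_zero] at ht2
    rw [hs1, mul_zero, add_zero, ← hts] at hs2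
    have h0 : t.1 0 ≠ 0 := by
      intro h
      rw [h, zero_mul] at ht2
      exact ha ht2.symm
    exact Prod.ext hts (EuclideanSpace.ext_fin_two
      (mul_left_cancel₀ h0 (ht2.trans hs2.symm)) (ht1.trans hs1.symm))
  have h3 := Finset.card_filter_add_card_filter_not (s := dotPairs a E) (fun t => t.2 1 ≠ 0)
  have h4 : (E.card : ℝ) ≤ (E.card : ℝ) ^ (4 / 3 : ℝ) := by
    rcases Nat.eq_zero_or_pos E.card with h | h
    · rw [h]
      simp
    · exact Real.self_le_rpow_of_one_le (by exact_mod_cast h) (by norm_num)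
  have h5 : ((dotPairs a E).card : ℝ) ≤ (incidences P L).card + E.card := by
    exact_mod_cast (by omega : (dotPairs a E).card ≤ (incidences P L).card + E.card)
  linarith

/-! ### Counting chains. -/

theorem card_dotChains_one_le (α : Fin 1 → ℝ) (E : Finset (EuclideanSpace ℝ (Fin 2))) :
    (dotChains α E).card ≤ (dotPairs (α 0) E).card := by
  refine Finset.card_le_card_of_injOn (fun R => (R 0, R 1)) ?_ ?_
  · intro R hR
    obtain ⟨h1, h2⟩ := (mem_dotChains α E R).1 hR
    exact Finset.mem_coe.2 (mem_dotPairs.2 ⟨⟨h1 0, h1 1⟩, h2 0⟩)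
  · intro R _ S _ hRS
    obtain ⟨h0, h1⟩ := Prod.mk.inj hRS
    funext i
    fin_cases i
    · exact h0
    · exact h1

/-- Two points with given dot products with both `u` and `v` coincide, unless `u` and `v` define
the same line. -/
theorem eq_of_inner_eq_of_inner_eq {u v x y : EuclideanSpace ℝ (Fin 2)} {a b : ℝ}
    (hux : inner ℝ u x = a) (hxv : inner ℝ x v = b) (huy : inner ℝ u y = a)
    (hyv : inner ℝ y v = b) (hne : a • v ≠ b • u) : x = y := by
  rw [EuclideanSpace.inner_fin_two] at hux hxv huy hyv
  by_cases hdet : u 0 * v 1 - u 1 * v 0 = 0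
  -- For dependent `u`, `v`, the common solution `x` forces `a • v = b • u`; otherwise Cramer's rule
  -- applies.
  · refine absurd (EuclideanSpace.ext_fin_two ?_ ?_) hne
    · simp only [PiLp.smul_apply, smul_eq_mul]
      rw [← hux, ← hxv]
      linear_combination -(x 1) * hdet
    · simp only [PiLp.smul_apply, smul_eq_mul]
      rw [← hux, ← hxv]
      linear_combination (x 0) * hdet
  · refine EuclideanSpace.ext_fin_two (mul_left_cancel₀ hdet ?_) (mul_left_cancel₀ hdet ?_)
    · linear_combination v 1 * (hux - huy) - u 1 * (hxv - hyv)
    · linear_combination -(v 0) * (hux - huy) + u 0 * (hxv - hyv)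

/-- If the end points define the same line for the middle point, then `R 0` determines `R 2`;
otherwise the two lines meet in at most one point and `R 0`, `R 2` determine `R 1`. Each case has at
most $n^2$ chains. -/
theorem card_dotChains_two_le {α : Fin 2 → ℝ} (hα : ∀ j, α j ≠ 0)
    (E : Finset (EuclideanSpace ℝ (Fin 2))) : (dotChains α E).card ≤ 2 * E.card ^ 2 := by
  classical
  have hmem : ∀ R ∈ dotChains α E, (∀ i, R i ∈ E) ∧ inner ℝ (R 0) (R 1) = α 0 ∧
      inner ℝ (R 1) (R 2) = α 1 := by
    intro R hR
    obtain ⟨h1, h2⟩ := (mem_dotChains α E R).1 hR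
    exact ⟨h1, h2 0, h2 1⟩
  have h1 : ((dotChains α E).filter fun R => α 0 • R 2 = α 1 • R 0).card ≤ E.card ^ 2 := by
    rw [sq, ← Finset.card_product]
    refine Finset.card_le_card_of_injOn (fun R => (R 0, R 1)) ?_ ?_
    · intro R hR
      have := hmem R (Finset.mem_filter.1 hR).1
      exact Finset.mem_coe.2 (Finset.mem_product.2 ⟨this.1 0, this.1 1⟩)
    · intro R hR S hS hRS
      have hR := (Finset.mem_filter.1 (Finset.mem_coe.1 hR)).2
      have hS := (Finset.mem_filter.1 (Finset.mem_coe.1 hS)).2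
      obtain ⟨e0, e1⟩ := Prod.mk.inj hRS
      rw [e0, ← hS] at hR
      funext i
      fin_cases i
      · exact e0
      · exact e1
      · exact smul_right_injective _ (hα 0) hR
  have h2 : ((dotChains α E).filter fun R => ¬ α 0 • R 2 = α 1 • R 0).card ≤ E.card ^ 2 := by
    rw [sq, ← Finset.card_product]
    refine Finset.card_le_card_of_injOn (fun R => (R 0, R 2)) ?_ ?_
    · intro R hR
      have := hmem R (Finset.mem_filter.1 hR).1
      exact Finset.mem_coe.2 (Finset.mem_product.2 ⟨this.1 0, this.1 2⟩)
    · intro R hR S hS hRS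
      obtain ⟨hR, hne⟩ := Finset.mem_filter.1 (Finset.mem_coe.1 hR)
      have hS := (Finset.mem_filter.1 (Finset.mem_coe.1 hS)).1
      obtain ⟨-, r1, r2⟩ := hmem R hR
      obtain ⟨-, s1, s2⟩ := hmem S hS
      obtain ⟨e0, e2⟩ := Prod.mk.inj hRS
      rw [← e0] at s1
      rw [← e2] at s2
      funext i
      fin_cases i
      · exact e0
      · exact eq_of_inner_eq_of_inner_eq r1 r2 s1 s2 hne
      · exact e2
  have h3 := Finset.card_filter_add_card_filter_not (s := dotChains α E)
    (fun R => α 0 • R 2 = α 1 • R 0)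
  omega

/-- The condition `α 1` linking the first edge to the rest is simply dropped. -/
theorem card_dotChains_add_two_le {k : ℕ} (α : Fin (k + 2) → ℝ)
    (E : Finset (EuclideanSpace ℝ (Fin 2))) : (dotChains α E).card ≤
      (dotPairs (α 0) E).card * (dotChains (fun j : Fin k => α j.succ.succ) E).card := by
  rw [← Finset.card_product]
  refine Finset.card_le_card_of_injOn (fun R => ((R 0, R 1), fun i => R i.succ.succ)) ?_ ?_
  · intro R hR
    obtain ⟨h1, h2⟩ := (mem_dotChains α E R).1 hR
    refine Finset.mem_coe.2 (Finset.mem_product.2 ⟨mem_dotPairs.2 ⟨⟨h1 0, h1 1⟩, h2 0⟩,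
      (mem_dotChains _ E _).2 ⟨fun i => h1 _, fun j => h2 j.succ.succ⟩⟩)
  · intro R _ S _ hRS
    obtain ⟨h01, h2⟩ := Prod.mk.inj hRS
    obtain ⟨h0, h1⟩ := Prod.mk.inj h01
    funext i
    refine Fin.cases h0 (fun i => Fin.cases h1 (fun i => congrFun h2 i) i) i

theorem mainTheorem1 (k : ℕ) (hk : 1 ≤ k) :
    ∃ C : ℝ, 0 < C ∧
      ∀ α : Fin k → ℝ, (∀ j, α j ≠ 0) →
        ∀ E : Finset (EuclideanSpace ℝ (Fin 2)),
          ((dotChains α E).card : ℝ) ≤ C * (E.card : ℝ) ^ (2 * ((k : ℝ) + 1) / 3) := by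
  induction k using Nat.twoStepInduction with
  | zero => omega
  | one =>
    refine ⟨6, by norm_num, fun α hα E => ?_⟩
    have h1 : ((dotChains α E).card : ℝ) ≤ (dotPairs (α 0) E).card := by
      exact_mod_cast card_dotChains_one_le α E
    refine h1.trans ((card_dotPairs_le (hα 0) E).trans_eq ?_)
    norm_num
  | more k ih _ =>
    -- The even case must start at 2: there are $n$ chains of length 0, more than $n^{2/3}$ allows.
    rcases Nat.eq_zero_or_pos k with rfl | hk0
    · refine ⟨2, by norm_num, fun α hα E => ?_⟩
      have h1 : ((dotChains α E).card : ℝ) ≤ 2 * (E.card : ℝ) ^ 2 := by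
        exact_mod_cast card_dotChains_two_le hα E
      refine h1.trans_eq ?_
      norm_num
    · obtain ⟨C, hC, h⟩ := ih hk0
      refine ⟨6 * C, by positivity, fun α hα E => ?_⟩
      have h1 : ((dotChains α E).card : ℝ) ≤ (dotPairs (α 0) E).card *
          (dotChains (fun j : Fin k => α j.succ.succ) E).card := by
        exact_mod_cast card_dotChains_add_two_le α E
      have h2 := card_dotPairs_le (hα 0) E
      have h3 := h (fun j => α j.succ.succ) (fun j => hα _) E
      calc ((dotChains α E).card : ℝ) ≤ _ := h1
        _ ≤ (6 * (E.card : ℝ) ^ (4 / 3 : ℝ)) * (C * (E.card : ℝ) ^ (2 * ((k : ℝ) + 1) / 3)) :=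
          mul_le_mul h2 h3 (by positivity) (by positivity)
        _ = 6 * C * ((E.card : ℝ) ^ (4 / 3 : ℝ) * (E.card : ℝ) ^ (2 * ((k : ℝ) + 1) / 3)) := by
          ring
        _ = 6 * C * (E.card : ℝ) ^ (2 * (((k + 2 : ℕ) : ℝ) + 1) / 3) := by
          rw [← Real.rpow_add_of_nonneg (by positivity) (by positivity) (by positivity)]
          congr 2
          push_cast
          ring
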